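/- Let $n\ge 1$, $r>0$, and let $\sigma_r$ be the surface measure of $S_r^{2n-1}=\{\zeta\in\mathbb C^n:|\zeta|=r\}$. Let $X(S_r^{2n-1}\times\mathbb R)$ be the space of finite complex Borel measures $\mu$ on $\mathbb C^n\times\mathbb R$ that are supported on $S_r^{2n-1}\times\mathbb R$ and absolutely continuous with respect to $d\sigma_r\,dt$; write $d\mu(\zeta,t)=f(\zeta,t)\,d\sigma_r(\zeta)\,dt$ with $f\in L^1$, and $f^\lambda(\zeta)=\int_{\mathbb R}f(\zeta,t)e^{i\lambda t}\,dt$. For $\lambda\in\mathbb R^*=\mathbb R\setminus\{0\}$ and $z=x+iy\in\mathbb C^n$ let $\pi_\lambda(z)$ be the unitary operator on $L^2(\mathbb R^n)$ given by $\pi_\lambda(z)\varphi(\xi)=e^{i\lambda(x\cdot\xi+\frac12x\cdot y)}\varphi(\xi+y)$, and define the modified Fourier transform of $\mu$ as the bounded operator on $L^2(\mathbb R^n)$ $$\mathcal F_M\mu(z,\lambda)=\int_{S_r^{2n-1}}e^{-i\lambda\,\mathrm{Im}(z\cdot\bar\zeta)}f^\lambda(\zeta)\,\pi_\lambda(\zeta)\,d\sigma_r(\zeta),\qquad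 z\cdot\bar\zeta=\sum_j z_j\bar\zeta_j,$$ the integral being taken in the strong sense. For $\alpha\in\mathbb Z_+^n$ let $\phi_\alpha(x)=\prod_jh_{\alpha_j}(x_j)$ be the normalized Hermite functions on $\mathbb R^n$, where $h_k(x)=(2^kk!\sqrt\pi)^{-1/2}H_k(x)e^{-x^2/2}$, and let $\phi_\alpha^\lambda(x)=|\lambda|^{n/4}\phi_\alpha(\sqrt{|\lambda|}\,x)$. Let $\mathcal C\subseteq\mathbb C^n=\mathbb R^{2n}$ be a real cone ($c\,\mathcal C\subseteq\mathcal C$ for all $c\in\mathbb R$) or a complex cone ($c\,\mathcal C\subseteq\mathcal C$ for all $c\in\mathbb C$) that is non-harmonic, i.e. not contained in the zero set of any nonzero homogeneous harmonic polynomial on $\mathbb R^{2n}$. For each $\lambda\in\mathbb R^*$ let $\alpha_\lambda\in\mathbb Z_+^n$ be given (arbitrarily) and put $U_\lambda=\mathrm{span}\{\phi^\lambda_{\alpha_\lambda}\}$. If $\mu\in X(S_r^{2n-1}\times\mathbb R)$ and the range of $\mathcal F_M\mu(\xi,\lambda)$ is contained in $U_\lambda^\perp$ for all $(\xi,\lambda)\in\mathcal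 C\times\mathbb R^*$, then $\mu=0$. -/

import Mathlib

open MeasureTheory
open scoped ENNReal NNReal InnerProductSpace

namespace HeisenbergUniqueness

noncomputable section

/-- `ℂⁿ` with its Hermitian norm. -/
abbrev Cn (n : ℕ) : Type := EuclideanSpace ℂ (Fin n)

/-- `ℝⁿ` with its Euclidean norm. -/
abbrev Rn (n : ℕ) : Type := EuclideanSpace ℝ (Fin n)

/-- The complex Hilbert space `L²(ℝⁿ)` with respect to Lebesgue measure. -/
abbrev L2 (n : ℕ) : Type := Lp ℂ 2 (volume : Measure (Rn n))

/-- The real part `x ∈ ℝⁿ` of `z = x + i y ∈ ℂⁿ`. -/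
def rePart {n : ℕ} (z : Cn n) : Rn n := WithLp.toLp 2 fun j => (z j).re

/-- The imaginary part `y ∈ ℝⁿ` of `z = x + i y ∈ ℂⁿ`. -/
def imPart {n : ℕ} (z : Cn n) : Rn n := WithLp.toLp 2 fun j => (z j).im

/-- The product `z · w̄ = ∑ⱼ zⱼ w̄ⱼ`. -/
def dotConj {n : ℕ} (z w : Cn n) : ℂ := ∑ j, z j * (starRingEnd ℂ) (w j)

/-! ### Cones and harmonic polynomials -/

/-- A subset of `ℂⁿ = ℝ²ⁿ` closed under multiplication by all real scalars. -/
def IsRealCone {n : ℕ} (C : Set (Cn n)) : Prop :=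
  ∀ c : ℝ, ∀ z ∈ C, (c : ℂ) • z ∈ C

/-- A subset of `ℂⁿ` closed under multiplication by all complex scalars. -/
def IsComplexCone {n : ℕ} (C : Set (Cn n)) : Prop :=
  ∀ c : ℂ, ∀ z ∈ C, c • z ∈ C

/-- Complex polynomials in the `2n` real coordinates of `ℂⁿ = ℝ²ⁿ`: the variable `Sum.inl j` is
`xⱼ = Re zⱼ` and the variable `Sum.inr j` is `yⱼ = Im zⱼ`. -/
abbrev RealPoly (n : ℕ) : Type := MvPolynomial (Fin n ⊕ Fin n) ℂ

/-- The value of a polynomial in the real coordinates at a point of `ℂⁿ`. -/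
def RealPoly.evalAt {n : ℕ} (P : RealPoly n) (z : Cn n) : ℂ :=
  MvPolynomial.eval (Sum.elim (fun j => ((z j).re : ℂ)) (fun j => ((z j).im : ℂ))) P

/-- The Euclidean Laplacian of `ℝ²ⁿ` on polynomials. -/
def RealPoly.laplacian {n : ℕ} (P : RealPoly n) : RealPoly n :=
  ∑ v : Fin n ⊕ Fin n, MvPolynomial.pderiv v (MvPolynomial.pderiv v P)

/-- `C` is non-harmonic: it is not contained in the zero set of any (nonzero) homogeneous harmonic
polynomial. -/
def NonHarmonic {n : ℕ} (C : Set (Cn n)) : Prop :=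
  ∀ (l : ℕ) (P : RealPoly n), P.IsHomogeneous l → P.laplacian = 0 → P ≠ 0 →
    ¬ C ⊆ {z | P.evalAt z = 0}

/-! ### Measures on the cylinder -/

/-- The surface measure `σ_r` of the sphere `S_r^{2n-1}` of radius `r`, as a Borel measure on `ℂⁿ`:
the image of the surface measure of the unit sphere under `ω ↦ r ω`, times `r^{2n-1}`. -/
def sphereMeasure (n : ℕ) (r : ℝ) : Measure (Cn n) :=
  (r.toNNReal ^ (2 * n - 1)) •
    ((volume : Measure (Cn n)).toSphere.map
      fun ω : Metric.sphere (0 : Cn n) 1 => r • (ω : Cn n))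

/-- The measure `dσ_r(ζ) dt` of the cylinder `S_r^{2n-1} × ℝ`, as a measure on `ℂⁿ × ℝ`. -/
def cylinderMeasure (n : ℕ) (r : ℝ) : Measure (Cn n × ℝ) :=
  (sphereMeasure n r).prod volume

/-- The space `X(S_r^{2n-1} × ℝ)` of finite complex Borel measures on `ℂⁿ × ℝ` that are absolutely
continuous with respect to `dσ_r dt`. As `dσ_r dt` vanishes off the cylinder, absolute continuity
forces such a measure to be carried by the cylinder. -/
def cylinderMeasures (n : ℕ) (r : ℝ) : Set (ComplexMeasure (Cn n × ℝ)) :=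
  {μ | VectorMeasure.AbsolutelyContinuous μ (cylinderMeasure n r).toENNRealVectorMeasure}

/-- The Radon–Nikodym density `f` of `μ`, that is `dμ(ζ, t) = f(ζ, t) dσ_r(ζ) dt` for `μ` in
`X(S_r^{2n-1} × ℝ)`. -/
def density (n : ℕ) (r : ℝ) (μ : ComplexMeasure (Cn n × ℝ)) : Cn n × ℝ → ℂ :=
  μ.rnDeriv (cylinderMeasure n r)

/-- The inverse Fourier transform in the `t`-variable, `f^λ(ζ) = ∫ f(ζ, t) e^{iλt} dt`. -/
def partialFourier {n : ℕ} (f : Cn n × ℝ → ℂ) (lam : ℝ) (ζ : Cn n) : ℂ :=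
  ∫ t : ℝ, f (ζ, t) * Complex.exp (Complex.I * (lam * t : ℝ))

/-! ### The Schrödinger representation -/

/-- The function `ξ ↦ e^{iλt} e^{iλ(x·ξ + x·y/2)} φ(ξ + y)`, where `z = x + i y`. -/
def schrodingerFun {n : ℕ} (lam : ℝ) (z : Cn n) (t : ℝ) (φ : Rn n → ℂ) (ξ : Rn n) : ℂ :=
  Complex.exp (Complex.I * (lam * t : ℝ)) *
    Complex.exp (Complex.I *
      (lam * (⟪rePart z, ξ⟫_ℝ + 1 / 2 * ⟪rePart z, imPart z⟫_ℝ) : ℝ)) *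
    φ (ξ + imPart z)

theorem memLp_schrodingerFun {n : ℕ} (lam : ℝ) (z : Cn n) (t : ℝ) (φ : L2 n) :
    MemLp (schrodingerFun lam z t φ) 2 (volume : Measure (Rn n)) := by
  have h1 : MemLp (fun ξ : Rn n => φ (ξ + imPart z)) 2 (volume : Measure (Rn n)) :=
    (Lp.memLp φ).comp_measurePreserving (measurePreserving_add_right volume (imPart z))
  refine h1.of_le (AEStronglyMeasurable.mul (Continuous.aestronglyMeasurable ?_) h1.1) ?_
  · fun_prop
  · refine Filter.Eventually.of_forall fun ξ => ?_
    simp only [schrodingerFun, norm_mul, mul_comm Complex.I, Complex.norm_exp_ofReal_mul_I,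
      one_mul, le_refl]

/-- The Schrödinger representation `π_λ(z, t)` on `L²(ℝⁿ)`. -/
def schrodinger {n : ℕ} (lam : ℝ) (z : Cn n) (t : ℝ) (φ : L2 n) : L2 n :=
  (memLp_schrodingerFun lam z t φ).toLp _

/-! ### Scaled Hermite functions -/

/-- The normalized Hermite function on `ℝ`,
`h_k(x) = (2^k k! √π)^{-1/2} H_k(x) e^{-x²/2}` with the physicists' Hermite polynomial
`H_k(x) = 2^{k/2} He_k(√2 x)`; Mathlib's `Polynomial.hermite k` is `He_k`. -/
def hermiteFun (k : ℕ) (x : ℝ) : ℝ :=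
  (Real.sqrt (k.factorial * Real.sqrt Real.pi))⁻¹ *
    Polynomial.aeval (Real.sqrt 2 * x) (Polynomial.hermite k) * Real.exp (-(x ^ 2) / 2)

/-- The scaled Hermite function `φ_α^λ(x) = |λ|^{n/4} φ_α(√|λ| x)` on `ℝⁿ`, where
`φ_α(x) = ∏ⱼ h_{αⱼ}(xⱼ)`. -/
def scaledHermiteFun {n : ℕ} (α : Fin n → ℕ) (lam : ℝ) (x : Rn n) : ℂ :=
  ((|lam| ^ ((n : ℝ) / 4) * ∏ j, hermiteFun (α j) (Real.sqrt |lam| * x j) : ℝ) : ℂ)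

theorem continuous_hermiteFun (k : ℕ) : Continuous (hermiteFun k) := by
  unfold hermiteFun
  fun_prop

theorem integrable_poly_mul_exp (p : Polynomial ℝ) :
    Integrable fun x : ℝ => p.eval x * Real.exp (-1 * x ^ 2) := by
  induction p using Polynomial.induction_on' with
  | add p q hp hq =>
    simp only [Polynomial.eval_add, add_mul]
    exact hp.add hq
  | monomial m a =>
    have h := integrable_rpow_mul_exp_neg_mul_sq (b := 1) one_pos (s := m)
      (by have := m.cast_nonneg (α := ℝ); linarith)
    simp only [Real.rpow_natCast] at h
    simpa only [Polynomial.eval_monomial, mul_assoc] using h.const_mul a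

theorem integrable_hermiteFun_sq (k : ℕ) : Integrable fun x : ℝ => hermiteFun k x ^ 2 := by
  have h := (integrable_poly_mul_exp
    ((((Polynomial.hermite k).map (Int.castRingHom ℝ)).comp
      (Polynomial.C (Real.sqrt 2) * Polynomial.X)) ^ 2)).const_mul
      ((Real.sqrt (k.factorial * Real.sqrt Real.pi))⁻¹ ^ 2)
  refine h.congr (Filter.Eventually.of_forall fun x => ?_)
  have h2 : Real.exp (-(x ^ 2) / 2) ^ 2 = Real.exp (-1 * x ^ 2) := by
    rw [← Real.exp_nat_mul]
    congr 1
    push_cast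
    ring
  simp only [hermiteFun, mul_pow, h2, Polynomial.eval_pow, Polynomial.eval_comp,
    Polynomial.eval_mul, Polynomial.eval_C, Polynomial.eval_X, Polynomial.eval_map,
    Polynomial.aeval_def, mul_assoc]
  rfl

theorem memLp_scaledHermiteFun {n : ℕ} (α : Fin n → ℕ) (lam : ℝ) :
    MemLp (scaledHermiteFun α lam) 2 (volume : Measure (Rn n)) := by
  have hc : Continuous (scaledHermiteFun α lam) := by
    unfold scaledHermiteFun
    have := continuous_hermiteFun
    fun_prop
  rw [memLp_two_iff_integrable_sq_norm hc.aestronglyMeasurable,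
    ← (PiLp.volume_preserving_toLp (Fin n)).integrable_comp_emb
      (MeasurableEquiv.toLp 2 (Fin n → ℝ)).measurableEmbedding]
  have h1 : ∀ j : Fin n, Integrable fun x : ℝ =>
      (|lam| ^ ((1 : ℝ) / 4) * hermiteFun (α j) (Real.sqrt |lam| * x)) ^ 2 := by
    intro j
    rcases eq_or_ne lam 0 with rfl | hl
    · simp
    · simp only [mul_pow]
      have hs : Real.sqrt |lam| ≠ 0 := (Real.sqrt_pos.2 (abs_pos.2 hl)).ne'
      exact ((integrable_hermiteFun_sq (α j)).comp_mul_left' hs).const_mul _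
  refine (Integrable.fintype_prod h1).congr (Filter.Eventually.of_forall fun x => ?_)
  have h2 : |lam| ^ ((n : ℝ) / 4) = ∏ _j : Fin n, |lam| ^ ((1 : ℝ) / 4) := by
    rw [Finset.prod_const, Finset.card_univ, Fintype.card_fin, ← Real.rpow_mul_natCast (abs_nonneg _)]
    congr 1
    ring
  simp only [Function.comp, scaledHermiteFun, Complex.norm_real, Real.norm_eq_abs, sq_abs, h2,
    ← Finset.prod_mul_distrib, Finset.prod_pow]

/-- The scaled Hermite function `φ_α^λ` as an element of `L²(ℝⁿ)`. -/
def scaledHermite {n : ℕ} (α : Fin n → ℕ) (lam : ℝ) : L2 n :=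
  (memLp_scaledHermiteFun α lam).toLp _

/-- The line `U = span {φ_α^λ}` in `L²(ℝⁿ)`. -/
def hermiteLine {n : ℕ} (α : Fin n → ℕ) (lam : ℝ) : Submodule ℂ (L2 n) :=
  Submodule.span ℂ {scaledHermite α lam}

/-! ### The modified Fourier transform -/

/-- The modified Fourier transform of `μ ∈ X(S_r^{2n-1} × ℝ)`, as an operator on `L²(ℝⁿ)`:
`𝓕_M μ(z, λ) φ = ∫_{S_r^{2n-1}} e^{-iλ Im(z · ζ̄)} f^λ(ζ) π_λ(ζ) φ dσ_r(ζ)`, where `f` is the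
density of `μ` and `π_λ(ζ) = π_λ(ζ, 0)`. The operator-valued integral is taken in the strong
sense, as a Bochner integral in `L²(ℝⁿ)` for every `φ`. -/
def modifiedFourier (n : ℕ) (r : ℝ) (μ : ComplexMeasure (Cn n × ℝ)) (z : Cn n) (lam : ℝ)
    (φ : L2 n) : L2 n :=
  ∫ ζ : Cn n, (Complex.exp (-(Complex.I * (lam * (dotConj z ζ).im : ℝ))) *
    partialFourier (density n r μ) lam ζ) • schrodinger lam ζ 0 φ ∂(sphereMeasure n r)

end

end HeisenbergUniqueness

open HeisenbergUniqueness

/-! Fix λ ≠ 0 and φ in L², and let g(ζ) be the pairing of the Hermite function with f^λ(ζ) π_λ(ζ)φ.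
The range condition says that the transform of g dσ_r with kernel exp(-iλ Im(z·ζ̄)) vanishes for z
in the cone. Since the cone is invariant under real scaling, this is equivalent to the vanishing
there of every moment Q_k(z) = ∫ Im(z·ζ̄)^k g(ζ) dσ_r(ζ).

Each Q_k is a homogeneous polynomial of degree k in the real coordinates of z, and |ζ| = r on the
sphere gives ΔQ_k = k(k-1) r² Q_{k-2}. By induction Q_{k-2} = 0, so Q_k is harmonic and vanishes on
a non-harmonic set; hence Q_k = 0 (`momentPoly_eq_zero_of_nonHarmonic`). Summing the exponential
series, the Fourier transform of g dσ_r vanishes everywhere, so g = 0 almost everywhere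
(`ae_eq_zero_of_symplecticFourier_eq_zero`).

Letting φ run over a countable dense set and using that π_λ(ζ) is onto gives f^λ = 0 almost
everywhere (`partialFourier_ae_eq_zero`). Fourier uniqueness in t then gives f = 0, and absolute
continuity gives μ = 0. -/

namespace HeisenbergUniqueness

/-! ### Uniqueness for Fourier transforms of integrable densities -/

section Fourier

variable {E : Type*} [NormedAddCommGroup E] [InnerProductSpace ℝ E] [CompleteSpace E]
  [SecondCountableTopology E] [MeasurableSpace E] [BorelSpace E] {ν : Measure E}

theorem norm_exp_I_mul_ofReal_le (a : ℝ) : ‖Complex.exp (Complex.I * (a : ℂ))‖ ≤ 1 := by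
  rw [mul_comm, Complex.norm_exp_ofReal_mul_I]

theorem integrable_exp_mul {X : Type*} [MeasurableSpace X] {ν : Measure X} {g : X → ℂ}
    (hg : Integrable g ν) {c : X → ℝ} (hc : AEStronglyMeasurable c ν) :
    Integrable (fun x => Complex.exp (Complex.I * (c x : ℂ)) * g x) ν := by
  refine hg.bdd_mul (c := 1) ?_ (Filter.Eventually.of_forall fun x => norm_exp_I_mul_ofReal_le _)
  exact Continuous.comp_aestronglyMeasurable (g := fun a : ℝ => Complex.exp (Complex.I * (a : ℂ)))
    (by fun_prop) hc

/-- The positive and negative parts of g are densities of finite measures. The hypothesis equates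
their characteristic functions, hence the measures, hence g⁺ = g⁻ almost everywhere, which forces
both to vanish. -/
theorem ae_eq_zero_of_fourier_eq_zero_real {g : E → ℝ} (hg : Integrable g ν)
    (h : ∀ w : E, ∫ x, Complex.exp (Complex.I * (⟪x, w⟫_ℝ : ℂ)) * (g x : ℂ) ∂ν = 0) :
    g =ᵐ[ν] 0 := by
  have key : ∀ u : E → ℝ, Integrable u ν → ∀ w : E,
      charFun (ν.withDensity fun x => ENNReal.ofReal (u x)) w =
        ∫ x, Complex.exp (Complex.I * (⟪x, w⟫_ℝ : ℂ)) * ((max (u x) 0 : ℝ) : ℂ) ∂ν := by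
    intro u hu w
    rw [charFun_apply, integral_withDensity_eq_integral_toReal_smul₀
      hu.aestronglyMeasurable.aemeasurable.ennreal_ofReal
      (Filter.Eventually.of_forall fun x => ENNReal.ofReal_lt_top)]
    refine integral_congr_ae (Filter.Eventually.of_forall fun x => ?_)
    simp only [ENNReal.toReal_ofReal', Complex.real_smul]
    rw [mul_comm, mul_comm Complex.I]
  have hint : ∀ u : E → ℝ, Integrable u ν → ∀ w : E,
      Integrable (fun x => Complex.exp (Complex.I * (⟪x, w⟫_ℝ : ℂ)) * ((max (u x) 0 : ℝ) : ℂ)) ν :=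
    fun u hu w => integrable_exp_mul hu.pos_part.ofReal
      (by fun_prop : Continuous fun x : E => ⟪x, w⟫_ℝ).aestronglyMeasurable
  have hfin : ∀ u : E → ℝ, Integrable u ν →
      IsFiniteMeasure (ν.withDensity fun x => ENNReal.ofReal (u x)) :=
    fun u hu => isFiniteMeasure_withDensity_ofReal hu.2
  have := hfin g hg
  have := hfin (fun x => -g x) hg.neg
  have heq : (ν.withDensity fun x => ENNReal.ofReal (g x)) =
      ν.withDensity fun x => ENNReal.ofReal (-g x) := by
    refine Measure.ext_of_charFun (funext fun w => ?_)
    rw [key g hg, key (fun x => -g x) hg.neg, ← sub_eq_zero,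
      ← integral_sub (hint g hg w) (hint (fun x => -g x) hg.neg w), ← h w]
    refine integral_congr_ae (Filter.Eventually.of_forall fun x => ?_)
    simp only [← mul_sub, ← Complex.ofReal_sub]
    congr 2
    rcases le_total (g x) 0 with h0 | h0
    · rw [max_eq_right h0, max_eq_left (by linarith)]; ring
    · rw [max_eq_left h0, max_eq_right (by linarith)]; ring
  rw [withDensity_eq_iff hg.aestronglyMeasurable.aemeasurable.ennreal_ofReal
    (show AEMeasurable (fun x => ENNReal.ofReal (-g x)) ν from
      hg.neg.aestronglyMeasurable.aemeasurable.ennreal_ofReal)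
    (hg.lintegral_lt_top.ne)] at heq
  filter_upwards [heq] with x hx
  rcases le_total (g x) 0 with h0 | h0
  · rw [ENNReal.ofReal_of_nonpos h0, eq_comm, ENNReal.ofReal_eq_zero] at hx
    exact le_antisymm h0 (by simpa using hx)
  · rw [ENNReal.ofReal_of_nonpos (show -g x ≤ 0 by linarith), ENNReal.ofReal_eq_zero] at hx
    exact le_antisymm hx h0

/-- The Fourier transform of an integrable density is injective. -/
theorem ae_eq_zero_of_fourier_eq_zero {g : E → ℂ} (hg : Integrable g ν)
    (h : ∀ w : E, ∫ x, Complex.exp (Complex.I * (⟪x, w⟫_ℝ : ℂ)) * g x ∂ν = 0) :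
    g =ᵐ[ν] 0 := by
  -- Conjugating the identity at -w shows that the conjugate of g satisfies the same hypothesis, so
  -- the real and imaginary parts of g can be treated separately.
  have hconj : ∀ w : E,
      ∫ x, Complex.exp (Complex.I * (⟪x, w⟫_ℝ : ℂ)) * (starRingEnd ℂ) (g x) ∂ν = 0 := by
    intro w
    have h1 := congrArg (starRingEnd ℂ) (h (-w))
    rw [← integral_conj, map_zero] at h1
    rw [← h1]
    refine integral_congr_ae (Filter.Eventually.of_forall fun x => ?_)
    simp only [map_mul, ← Complex.exp_conj, Complex.conj_I, Complex.conj_ofReal, inner_neg_right,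
      Complex.ofReal_neg, neg_mul_neg, map_neg]
  have hgc : Integrable (fun x => (starRingEnd ℂ) (g x)) ν :=
    hg.congr' (Complex.continuous_conj.comp_aestronglyMeasurable hg.1)
      (Filter.Eventually.of_forall fun x => by simp)
  have hm : ∀ w : E, AEStronglyMeasurable (fun x : E => ⟪x, w⟫_ℝ) ν := fun w =>
    (by fun_prop : Continuous fun x : E => ⟪x, w⟫_ℝ).aestronglyMeasurable
  have hre := ae_eq_zero_of_fourier_eq_zero_real hg.re fun w => by
    have h2 : (∫ x, Complex.exp (Complex.I * (⟪x, w⟫_ℝ : ℂ)) * g x ∂ν +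
        ∫ x, Complex.exp (Complex.I * (⟪x, w⟫_ℝ : ℂ)) * (starRingEnd ℂ) (g x) ∂ν) * (1 / 2) = 0 := by
      rw [h, hconj]; ring
    rw [← integral_add (integrable_exp_mul hg (hm w)) (integrable_exp_mul hgc (hm w)),
      ← integral_mul_const] at h2
    rw [← h2]
    refine integral_congr_ae (Filter.Eventually.of_forall fun x => ?_)
    simp only [RCLike.re_eq_complex_re, Complex.re_eq_add_conj]
    ring
  have him := ae_eq_zero_of_fourier_eq_zero_real hg.im fun w => by
    have h2 : (∫ x, Complex.exp (Complex.I * (⟪x, w⟫_ℝ : ℂ)) * g x ∂ν -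
        ∫ x, Complex.exp (Complex.I * (⟪x, w⟫_ℝ : ℂ)) * (starRingEnd ℂ) (g x) ∂ν) *
          (1 / (2 * Complex.I)) = 0 := by
      rw [h, hconj]; ring
    rw [← integral_sub (integrable_exp_mul hg (hm w)) (integrable_exp_mul hgc (hm w)),
      ← integral_mul_const] at h2
    rw [← h2]
    refine integral_congr_ae (Filter.Eventually.of_forall fun x => ?_)
    simp only [RCLike.im_eq_complex_im, Complex.im_eq_sub_conj]
    ring
  filter_upwards [hre, him] with x h1 h2
  exact Complex.ext h1 h2

end Fourier

/-! ### Exponential integrals and moments of a bounded phase -/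

section Moments

variable {X : Type*} [MeasurableSpace X] {ν : Measure X} {c : X → ℝ} {B : ℝ}

theorem integrable_pow_mul_of_bounded (hc : AEStronglyMeasurable c ν)
    (hB : ∀ᵐ x ∂ν, |c x| ≤ B) {g : X → ℂ} (hg : Integrable g ν) (k : ℕ) :
    Integrable (fun x => (c x : ℂ) ^ k * g x) ν := by
  refine hg.bdd_mul (c := B ^ k)
    ((by fun_prop : Continuous fun a : ℝ => (a : ℂ) ^ k).comp_aestronglyMeasurable hc) ?_
  filter_upwards [hB] with x hx
  rw [norm_pow, Complex.norm_real]
  exact pow_le_pow_left₀ (norm_nonneg _) hx k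

/-- Differentiation in s under the integral sign, dominated by |c g|, brings down a factor ic.
Iterating this and setting s = 0 yields all moments. -/
theorem integral_exp_mul_coeff_eq_zero (hc : AEStronglyMeasurable c ν)
    (hB : ∀ᵐ x ∂ν, |c x| ≤ B) {g : X → ℂ} (hg : Integrable g ν)
    (h : ∀ s : ℝ, ∫ x, Complex.exp (Complex.I * ((s * c x : ℝ) : ℂ)) * g x ∂ν = 0) (s : ℝ) :
    ∫ x, Complex.exp (Complex.I * ((s * c x : ℝ) : ℂ)) * ((c x : ℂ) * g x) ∂ν = 0 := by
  have hcg : Integrable (fun x => (c x : ℂ) * g x) ν := by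
    simpa using integrable_pow_mul_of_bounded hc hB hg 1
  have hd := (hasDerivAt_integral_of_dominated_loc_of_deriv_le (𝕜 := ℝ) (μ := ν)
    (F := fun s x => Complex.exp (Complex.I * ((s * c x : ℝ) : ℂ)) * g x)
    (F' := fun s x => Complex.exp (Complex.I * ((s * c x : ℝ) : ℂ)) *
      (Complex.I * ((c x : ℂ) * g x)))
    (bound := fun x => ‖(c x : ℂ) * g x‖) (x₀ := s) (s := Set.univ) Filter.univ_mem
    (Filter.Eventually.of_forall fun s => (integrable_exp_mul hg (hc.const_mul s)).1)
    (integrable_exp_mul hg (hc.const_mul s))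
    (integrable_exp_mul (hcg.const_mul _) (hc.const_mul s)).1
    (Filter.Eventually.of_forall fun x s _ => by
      rw [norm_mul, norm_mul Complex.I, Complex.norm_I, one_mul]
      exact mul_le_of_le_one_left (norm_nonneg _) (norm_exp_I_mul_ofReal_le _))
    hcg.norm
    (Filter.Eventually.of_forall fun x s _ => by
      have h1 : HasDerivAt (fun s : ℝ => Complex.I * ((s * c x : ℝ) : ℂ)) (Complex.I * (c x : ℂ)) s := by
        have := ((hasDerivAt_id s).mul_const (c x)).ofReal_comp.const_mul Complex.I
        simpa using this
      have h2 := h1.cexp.mul_const (g x)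
      exact h2.congr_deriv (by ring))).2
  have h0 : HasDerivAt (fun _ : ℝ => (0 : ℂ)) 0 s := hasDerivAt_const _ _
  simp only [h] at hd
  have h3 := hd.unique h0
  have h4 : (fun x => Complex.exp (Complex.I * ((s * c x : ℝ) : ℂ)) *
      (Complex.I * ((c x : ℂ) * g x))) =
      fun x => Complex.I * (Complex.exp (Complex.I * ((s * c x : ℝ) : ℂ)) * ((c x : ℂ) * g x)) := by
    ext x; ring
  rw [h4, integral_const_mul] at h3
  exact (mul_eq_zero.1 h3).resolve_left Complex.I_ne_zero

theorem moments_eq_zero_of_fourier_eq_zero (hc : AEStronglyMeasurable c ν)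
    (hB : ∀ᵐ x ∂ν, |c x| ≤ B) {g : X → ℂ} (hg : Integrable g ν)
    (h : ∀ s : ℝ, ∫ x, Complex.exp (Complex.I * ((s * c x : ℝ) : ℂ)) * g x ∂ν = 0) (k : ℕ) :
    ∫ x, (c x : ℂ) ^ k * g x ∂ν = 0 := by
  have key : ∀ s : ℝ, ∫ x, Complex.exp (Complex.I * ((s * c x : ℝ) : ℂ)) *
      ((c x : ℂ) ^ k * g x) ∂ν = 0 := by
    induction k with
    | zero => simpa using h
    | succ k ih =>
      intro s
      have := integral_exp_mul_coeff_eq_zero hc hB (integrable_pow_mul_of_bounded hc hB hg k) ih s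
      simpa only [pow_succ', mul_assoc] using this
  simpa using key 0

/-- The exponential series may be integrated term by term because its k-th term is dominated by
B^k/k! · |g|. -/
theorem fourier_eq_zero_of_moments_eq_zero (hc : AEStronglyMeasurable c ν)
    (hB : ∀ᵐ x ∂ν, |c x| ≤ B) {g : X → ℂ} (hg : Integrable g ν)
    (h : ∀ k : ℕ, ∫ x, (c x : ℂ) ^ k * g x ∂ν = 0) :
    ∫ x, Complex.exp (Complex.I * (c x : ℂ)) * g x ∂ν = 0 := by
  have hi := fun k => integrable_pow_mul_of_bounded hc hB hg k
  have hs := hasSum_integral_of_dominated_convergence (μ := ν)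
    (F := fun (k : ℕ) x => Complex.I ^ k / k.factorial * ((c x : ℂ) ^ k * g x))
    (f := fun x => Complex.exp (Complex.I * (c x : ℂ)) * g x)
    (fun k x => B ^ k / k.factorial * ‖g x‖)
    (fun k => ((hi k).const_mul _).1)
    (fun k => by
      filter_upwards [hB] with x hx
      rw [norm_mul, norm_div, norm_pow, Complex.norm_I, one_pow, norm_mul, norm_pow,
        Complex.norm_real, Complex.norm_natCast, ← mul_assoc, div_mul_eq_mul_div, one_mul]
      gcongr
      exact hx)
    (Filter.Eventually.of_forall fun x => (Real.summable_pow_div_factorial B).mul_right _)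
    (by
      simp only [tsum_mul_right]
      exact hg.norm.const_mul _)
    (Filter.Eventually.of_forall fun x => by
      have h1 := (NormedSpace.expSeries_div_hasSum_exp (𝔸 := ℂ) (Complex.I * (c x : ℂ))).mul_right (g x)
      rw [← Complex.exp_eq_exp_ℂ] at h1
      refine h1.congr_fun ?_
      intro k
      rw [mul_pow]; ring)
  have h0 : ∀ k : ℕ, ∫ x, Complex.I ^ k / k.factorial * ((c x : ℂ) ^ k * g x) ∂ν = 0 := fun k => by
    rw [integral_const_mul, h, mul_zero]
  simp only [h0] at hs
  exact hs.unique hasSum_zero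

end Moments

/-! ### Moment polynomials and their Laplacian -/

section LinearForms

open MvPolynomial
variable {σ : Type*} [Fintype σ]

/-- The linear form `∑ᵥ aᵥ Xᵥ`. -/
noncomputable def linForm (a : σ → ℂ) : MvPolynomial σ ℂ := ∑ v, C (a v) * X v

theorem isHomogeneous_linForm (a : σ → ℂ) : (linForm a).IsHomogeneous 1 :=
  IsHomogeneous.sum _ _ _ fun v _ => by
    simpa using (isHomogeneous_C σ (a v)).mul (isHomogeneous_X ℂ v)

theorem isHomogeneous_linForm_pow (a : σ → ℂ) (k : ℕ) : (linForm a ^ k).IsHomogeneous k := by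
  simpa using (isHomogeneous_linForm a).pow k

theorem eval_linForm (a x : σ → ℂ) : eval x (linForm a) = ∑ v, a v * x v := by
  simp [linForm]

theorem pderiv_linForm (a : σ → ℂ) (v : σ) : pderiv v (linForm a) = C (a v) := by
  classical
  simp [linForm, pderiv_X, Pi.single_apply]

/-- The sum of the a_v² is bilinear rather than Hermitian; for the real coefficients used later it
is the squared norm, constant on a sphere. -/
theorem sum_pderiv_pderiv_linForm_pow (a : σ → ℂ) (k : ℕ) :
    ∑ v, pderiv v (pderiv v (linForm a ^ (k + 2))) =
      C (((k + 2) * (k + 1) : ℂ) * ∑ v, a v ^ 2) * linForm a ^ k := by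
  have h : ∀ v, pderiv v (pderiv v (linForm a ^ (k + 2))) =
      C (((k + 2) * (k + 1) : ℂ) * a v ^ 2) * linForm a ^ k := by
    intro v
    rw [pderiv_pow, pderiv_linForm, pderiv_mul, pderiv_mul, pderiv_C, pderiv_pow, pderiv_linForm]
    simp only [map_natCast, Derivation.map_natCast, Nat.add_sub_cancel,
      show k + 2 - 1 = k + 1 by omega, map_mul, map_add, map_pow, map_one, map_ofNat]
    push_cast
    ring
  rw [Finset.sum_congr rfl fun v _ => h v, ← Finset.sum_mul, ← map_sum, Finset.mul_sum]

theorem continuous_coeff_linForm_pow {T : Type*} [TopologicalSpace T] {a : T → σ → ℂ}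
    (ha : Continuous a) (k : ℕ) (s : σ →₀ ℕ) : Continuous fun t => coeff s (linForm (a t) ^ k) := by
  classical
  induction k generalizing s with
  | zero => simpa using continuous_const
  | succ k ih =>
    simp only [pow_succ, coeff_mul]
    refine continuous_finsetSum _ fun p _ => (ih p.1).mul ?_
    simp only [linForm, coeff_sum, coeff_C_mul]
    fun_prop

/-- The exponents of total degree `k`. -/
noncomputable def degreeExponents (σ : Type*) [Fintype σ] (k : ℕ) : Finset (σ →₀ ℕ) :=
  by classical exact Finset.finsuppAntidiag Finset.univ k

theorem mem_degreeExponents {k : ℕ} {s : σ →₀ ℕ} : s ∈ degreeExponents σ k ↔ s.degree = k := by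
  classical
  simp [degreeExponents, Finset.mem_finsuppAntidiag, Finsupp.degree_eq_sum]

/-- The index set depends only on the degree, not on the support of P, so the sum can be exchanged
with an integral over a family of polynomials. -/
theorem eval_eq_sum_degreeExponents {k : ℕ} {P : MvPolynomial σ ℂ} (hP : P.IsHomogeneous k)
    (x : σ → ℂ) : eval x P = ∑ s ∈ degreeExponents σ k, coeff s P * ∏ v, x v ^ s v := by
  rw [eval_eq']
  refine Finset.sum_subset (fun s hs => ?_) fun s _ hs => ?_
  · rw [mem_degreeExponents]
    by_contra hne
    exact mem_support_iff.1 hs (hP.coeff_eq_zero hne)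
  · rw [notMem_support_iff.1 hs, zero_mul]

variable {T : Type*} [MeasurableSpace T] (ν : Measure T) (a : T → σ → ℂ) (g : T → ℂ)

/-- The polynomial `x ↦ ∫ (∑ᵥ aᵥ(t) xᵥ)ᵏ g(t) dν(t)`. -/
noncomputable def momentPoly (k : ℕ) : MvPolynomial σ ℂ :=
  ∑ s ∈ degreeExponents σ k, monomial s (∫ t, coeff s (linForm (a t) ^ k) * g t ∂ν)

theorem coeff_momentPoly (k : ℕ) (s : σ →₀ ℕ) :
    coeff s (momentPoly ν a g k) = ∫ t, coeff s (linForm (a t) ^ k) * g t ∂ν := by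
  classical
  simp only [momentPoly, coeff_sum, coeff_monomial, Finset.sum_ite_eq', mem_degreeExponents]
  split_ifs with h
  · rfl
  · simp [fun t => (isHomogeneous_linForm_pow (a t) k).coeff_eq_zero h]

theorem isHomogeneous_momentPoly (k : ℕ) : (momentPoly ν a g k).IsHomogeneous k :=
  IsHomogeneous.sum _ _ _ fun _ hs => isHomogeneous_monomial _ (mem_degreeExponents.1 hs)

variable {ν a g}

theorem eval_momentPoly {k : ℕ}
    (hi : ∀ s : σ →₀ ℕ, Integrable (fun t => coeff s (linForm (a t) ^ k) * g t) ν) (x : σ → ℂ) :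
    eval x (momentPoly ν a g k) = ∫ t, (∑ v, a t v * x v) ^ k * g t ∂ν := by
  rw [eval_eq_sum_degreeExponents (isHomogeneous_momentPoly ν a g k)]
  simp only [coeff_momentPoly, ← eval_linForm, ← map_pow,
    fun t => eval_eq_sum_degreeExponents (isHomogeneous_linForm_pow (a t) k), Finset.sum_mul]
  rw [integral_finsetSum]
  · refine Finset.sum_congr rfl fun s _ => ?_
    rw [← integral_mul_const]
    exact integral_congr_ae (Filter.Eventually.of_forall fun t => by ring)
  · intro s _
    exact ((hi s).mul_const (∏ v, x v ^ s v)).congr (Filter.Eventually.of_forall fun t => by ring)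

/-- Coefficientwise the Laplacian is a finite linear combination, so it commutes with the integral
defining `momentPoly` without differentiating under the integral sign. -/
theorem coeff_sum_pderiv_pderiv (P : MvPolynomial σ ℂ) (s : σ →₀ ℕ) :
    coeff s (∑ v, pderiv v (pderiv v P)) =
      ∑ v, coeff (s + Finsupp.single v 1 + Finsupp.single v 1) P *
        (((s v + 1 + 1 : ℕ) : ℂ) * ((s v : ℂ) + 1)) := by
  rw [coeff_sum]
  refine Finset.sum_congr rfl fun v _ => ?_
  rw [coeff_pderiv, coeff_pderiv]
  simp
  ring

/-- The recursion behind the induction: constancy of the sum of squares lets R leave the integral.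
-/
theorem laplacian_momentPoly_add_two {k : ℕ} {R : ℂ}
    (hi : ∀ s : σ →₀ ℕ, Integrable (fun t => coeff s (linForm (a t) ^ (k + 2)) * g t) ν)
    (hR : ∀ᵐ t ∂ν, ∑ v, a t v ^ 2 = R) :
    ∑ v, pderiv v (pderiv v (momentPoly ν a g (k + 2))) =
      C (((k + 2) * (k + 1) : ℂ) * R) * momentPoly ν a g k := by
  ext s
  rw [coeff_sum_pderiv_pderiv, coeff_C_mul, coeff_momentPoly]
  simp only [coeff_momentPoly]
  rw [← integral_const_mul]
  simp only [← integral_mul_const]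
  rw [← integral_finsetSum _ fun v _ => (hi _).mul_const _]
  refine integral_congr_ae ?_
  filter_upwards [hR] with t ht
  rw [← mul_assoc, ← ht, ← coeff_C_mul, ← sum_pderiv_pderiv_linForm_pow, coeff_sum_pderiv_pderiv,
    Finset.sum_mul]
  exact Finset.sum_congr rfl fun v _ => by ring

theorem laplacian_momentPoly_of_lt_two {k : ℕ} (hk : k < 2) :
    ∑ v, pderiv v (pderiv v (momentPoly ν a g k)) = 0 := by
  ext s
  rw [coeff_sum_pderiv_pderiv, coeff_zero]
  refine Finset.sum_eq_zero fun v _ => ?_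
  rw [(isHomogeneous_momentPoly ν a g k).coeff_eq_zero, zero_mul]
  simp only [map_add, Finsupp.degree_single]
  omega

end LinearForms

/-! ### Isometry, surjectivity and strong measurability of π_λ; nonvanishing of Hermite functions -/

section Schrodinger

variable {n : ℕ}

theorem continuous_rePart : Continuous (rePart : Cn n → Rn n) := by
  unfold rePart; fun_prop

theorem continuous_imPart : Continuous (imPart : Cn n → Rn n) := by
  unfold imPart; fun_prop

theorem schrodingerFun_congr {lam : ℝ} {z : Cn n} {t : ℝ} {φ ψ : Rn n → ℂ}
    (h : φ =ᵐ[volume] ψ) : schrodingerFun lam z t φ =ᵐ[volume] schrodingerFun lam z t ψ := by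
  have h1 := (measurePreserving_add_right (volume : Measure (Rn n))
    (imPart z)).quasiMeasurePreserving.ae_eq_comp h
  filter_upwards [h1] with ξ hξ
  simp only [Function.comp] at hξ
  simp only [schrodingerFun, hξ]

theorem schrodinger_sub (lam : ℝ) (z : Cn n) (t : ℝ) (φ ψ : L2 n) :
    schrodinger lam z t (φ - ψ) = schrodinger lam z t φ - schrodinger lam z t ψ := by
  unfold schrodinger
  rw [← MemLp.toLp_sub]
  refine MemLp.toLp_congr _ _ ((schrodingerFun_congr (Lp.coeFn_sub φ ψ)).trans ?_)
  refine Filter.Eventually.of_forall fun ξ => ?_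
  simp only [schrodingerFun, Pi.sub_apply]
  ring

theorem norm_schrodinger (lam : ℝ) (z : Cn n) (t : ℝ) (φ : L2 n) :
    ‖schrodinger lam z t φ‖ = ‖φ‖ := by
  rw [schrodinger, Lp.norm_toLp, Lp.norm_def]
  congr 1
  rw [← eLpNorm_comp_measurePreserving (Lp.aestronglyMeasurable φ)
    (measurePreserving_add_right volume (imPart z))]
  refine eLpNorm_congr_norm_ae (Filter.Eventually.of_forall fun ξ => ?_)
  simp only [schrodingerFun, norm_mul, mul_comm Complex.I, Complex.norm_exp_ofReal_mul_I,
    one_mul, Function.comp]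

theorem continuous_schrodinger (lam : ℝ) (z : Cn n) (t : ℝ) :
    Continuous (schrodinger (n := n) lam z t) :=
  (Isometry.of_dist_eq fun φ ψ => by
    rw [dist_eq_norm, dist_eq_norm, ← schrodinger_sub, norm_schrodinger]).continuous

theorem schrodinger_neg_right_inverse (lam : ℝ) (z : Cn n) (φ : L2 n) :
    schrodinger lam z 0 (schrodinger lam (-z) 0 φ) = φ := by
  refine Lp.ext ?_
  refine (MemLp.coeFn_toLp _).trans
    ((schrodingerFun_congr (MemLp.coeFn_toLp (memLp_schrodingerFun lam (-z) 0 φ))).trans ?_)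
  refine Filter.Eventually.of_forall fun ξ => ?_
  have hre : rePart (-z) = -rePart z := by ext j; simp [rePart]
  have him : imPart (-z) = -imPart z := by ext j; simp [imPart]
  simp only [schrodingerFun, hre, him, add_neg_cancel_right, ← mul_assoc, ← Complex.exp_add]
  -- The phases cancel: the shift by y in the inner exponent contributes -λ x·y, against two terms λ
  -- x·y/2.
  convert one_mul _
  rw [← Complex.exp_zero]
  congr 1
  simp only [inner_neg_left, inner_neg_right, inner_add_right]
  push_cast
  ring

theorem measurable_of_measurable_dist {X Y : Type*} [MeasurableSpace X] [PseudoMetricSpace Y]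
    [SecondCountableTopology Y] [MeasurableSpace Y] [BorelSpace Y] {f : X → Y}
    (h : ∀ y, Measurable fun x => dist (f x) y) : Measurable f := by
  have hb : TopologicalSpace.IsTopologicalBasis
      {s : Set Y | ∃ (y : Y) (r : ℝ), s = Metric.ball y r} := by
    refine TopologicalSpace.isTopologicalBasis_of_isOpen_of_nhds ?_ fun a u ha hu => ?_
    · rintro _ ⟨y, r, rfl⟩
      exact Metric.isOpen_ball
    · obtain ⟨ε, hε, hsub⟩ := Metric.isOpen_iff.1 hu a ha
      exact ⟨_, ⟨a, ε, rfl⟩, Metric.mem_ball_self hε, hsub⟩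
  rw [BorelSpace.measurable_eq (α := Y), hb.borel_eq_generateFrom]
  refine measurable_generateFrom ?_
  rintro _ ⟨y, r, rfl⟩
  exact measurableSet_lt (h y) measurable_const

/-- L² is separable, so it suffices that the distance to each ψ is measurable in z. That distance is
a parameter integral of a jointly measurable function. -/
theorem stronglyMeasurable_schrodinger (lam : ℝ) (φ : L2 n) :
    StronglyMeasurable fun z : Cn n => schrodinger lam z 0 φ := by
  borelize (L2 n)
  have : Fact ((2 : ℝ≥0∞) ≠ ∞) := ⟨by simp⟩
  refine (measurable_of_measurable_dist fun ψ => ?_).stronglyMeasurable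
  have h1 : ∀ z : Cn n, dist (schrodinger lam z 0 φ) ψ =
      ((∫⁻ ξ, ‖schrodingerFun lam z 0 φ ξ - ψ ξ‖ₑ ^ (2 : ℝ)) ^ (1 / (2 : ℝ))).toReal := by
    intro z
    rw [Lp.dist_def, eLpNorm_eq_lintegral_rpow_enorm_toReal (by simp) (by simp)]
    simp only [ENNReal.toReal_ofNat]
    congr 2
    refine lintegral_congr_ae ?_
    filter_upwards [MemLp.coeFn_toLp (memLp_schrodingerFun lam z 0 φ)] with ξ hξ
    simp only [Pi.sub_apply, schrodinger, hξ]
  simp only [h1]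
  have hφ := (Lp.stronglyMeasurable φ).measurable
  have hψ := (Lp.stronglyMeasurable ψ).measurable
  have hr := continuous_rePart (n := n)
  have hi := continuous_imPart (n := n)
  have h2 : Measurable fun p : Cn n × Rn n => schrodingerFun lam p.1 0 φ p.2 := by
    unfold schrodingerFun
    refine Measurable.mul (Continuous.measurable ?_) (hφ.comp ?_)
    · fun_prop
    · fun_prop
  have h3 : Measurable fun p : Cn n × Rn n =>
      ‖schrodingerFun lam p.1 0 φ p.2 - ψ p.2‖ₑ ^ (2 : ℝ) :=
    ((h2.sub (hψ.comp measurable_snd)).enorm).pow_const _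
  exact (h3.lintegral_prod_right'.pow_const _).ennreal_toReal

theorem exists_hermiteFun_ne_zero (k : ℕ) : ∃ x, hermiteFun k x ≠ 0 := by
  set q : Polynomial ℝ := (Polynomial.hermite k).map (Int.castRingHom ℝ) with hq
  have hq0 : q ≠ 0 := ((Polynomial.hermite_monic k).map _).ne_zero
  obtain ⟨y, hy⟩ := Polynomial.exists_eval_ne_zero_of_natDegree_lt_card q hq0 (by
    rw [Cardinal.mk_real]; exact Cardinal.nat_lt_continuum _)
  refine ⟨y / Real.sqrt 2, ?_⟩
  have h2 : Real.sqrt 2 * (y / Real.sqrt 2) = y := by field_simp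
  have h3 : Polynomial.aeval y (Polynomial.hermite k) ≠ 0 := by
    rw [hq, Polynomial.eval_map] at hy
    exact hy
  unfold hermiteFun
  rw [h2]
  have : (0 : ℝ) < k.factorial := by positivity
  refine mul_ne_zero (mul_ne_zero (inv_ne_zero ?_) h3) (Real.exp_ne_zero _)
  positivity

theorem scaledHermite_ne_zero (α : Fin n → ℕ) {lam : ℝ} (hlam : lam ≠ 0) :
    scaledHermite α lam ≠ 0 := by
  intro h
  have hc : Continuous (scaledHermiteFun α lam) := by
    unfold scaledHermiteFun
    have := continuous_hermiteFun
    fun_prop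
  have h0 : scaledHermiteFun α lam =ᵐ[volume] fun _ => 0 := by
    refine (MemLp.coeFn_toLp (memLp_scaledHermiteFun α lam)).symm.trans ?_
    change (scaledHermite α lam : Rn n → ℂ) =ᵐ[volume] _
    rw [h]
    exact Lp.coeFn_zero _ _ _
  have h1 := hc.ae_eq_iff_eq volume continuous_const |>.1 h0
  choose x hx using fun j => exists_hermiteFun_ne_zero (α j)
  -- Dividing by √|λ| undoes the scaling, so each factor is evaluated at a point where it is
  -- nonzero.
  have h2 := congrFun h1 (WithLp.toLp 2 fun j => x j / Real.sqrt |lam|)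
  have hpos : 0 < |lam| := abs_pos.2 hlam
  have hs : Real.sqrt |lam| ≠ 0 := (Real.sqrt_pos.2 hpos).ne'
  simp only [scaledHermiteFun, Complex.ofReal_eq_zero, mul_div_cancel₀ _ hs] at h2
  rcases mul_eq_zero.1 h2 with h3 | h3
  · exact (Real.rpow_pos_of_pos hpos _).ne' h3
  · obtain ⟨j, -, hj⟩ := Finset.prod_eq_zero_iff.1 h3
    exact hx j hj

end Schrodinger

/-! ### The symplectic Fourier transform on the sphere and non-harmonic cones -/

section Sphere

variable {n : ℕ} {r : ℝ}

instance isFiniteMeasure_sphereMeasure (n : ℕ) (r : ℝ) : IsFiniteMeasure (sphereMeasure n r) := by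
  unfold sphereMeasure
  infer_instance

theorem ae_norm_eq_sphereMeasure (n : ℕ) (hr : 0 ≤ r) : ∀ᵐ ζ ∂(sphereMeasure n r), ‖ζ‖ = r := by
  unfold sphereMeasure
  refine Measure.ae_smul_measure ?_ _
  rw [ae_map_iff (by fun_prop) (measurableSet_eq_fun measurable_norm measurable_const)]
  refine Filter.Eventually.of_forall fun ω => ?_
  rw [norm_smul, norm_eq_of_mem_sphere, mul_one, Real.norm_of_nonneg hr]

/-- The coefficients of the real-linear form `z ↦ Im (z · ζ̄)`. -/
noncomputable def symplecticCoeff (ζ : Cn n) : Fin n ⊕ Fin n → ℂ :=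
  Sum.elim (fun j => (-((ζ j).im) : ℂ)) fun j => ((ζ j).re : ℂ)

theorem continuous_symplecticCoeff : Continuous (symplecticCoeff (n := n)) := by
  refine continuous_pi fun v => ?_
  rcases v with j | j <;> simp only [symplecticCoeff, Sum.elim_inl, Sum.elim_inr] <;> fun_prop

theorem sum_symplecticCoeff_mul (z ζ : Cn n) :
    ∑ v, symplecticCoeff ζ v *
      Sum.elim (fun j => ((z j).re : ℂ)) (fun j => ((z j).im : ℂ)) v = ((dotConj z ζ).im : ℂ) := by
  simp only [symplecticCoeff, Fintype.sum_sum_type, Sum.elim_inl, Sum.elim_inr, dotConj,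
    Complex.im_sum, Complex.mul_im, Complex.conj_re, Complex.conj_im, Complex.ofReal_sum]
  rw [← Finset.sum_add_distrib]
  refine Finset.sum_congr rfl fun j _ => ?_
  push_cast
  ring

theorem sum_symplecticCoeff_sq (ζ : Cn n) : ∑ v, symplecticCoeff ζ v ^ 2 = ((‖ζ‖ ^ 2 : ℝ) : ℂ) := by
  rw [EuclideanSpace.norm_sq_eq]
  simp only [symplecticCoeff, Fintype.sum_sum_type, Sum.elim_inl, Sum.elim_inr, Complex.ofReal_sum,
    Complex.sq_norm, Complex.normSq_apply]
  rw [← Finset.sum_add_distrib]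
  refine Finset.sum_congr rfl fun j _ => ?_
  push_cast
  ring

theorem continuous_dotConj_im (z : Cn n) : Continuous fun ζ : Cn n => (dotConj z ζ).im := by
  unfold dotConj
  fun_prop

theorem dotConj_smul (c : ℂ) (z ζ : Cn n) : dotConj (c • z) ζ = c * dotConj z ζ := by
  simp [dotConj, Finset.mul_sum, mul_assoc]

/-- Multiplication by i turns the symplectic phase into the Euclidean one, so ordinary Fourier
uniqueness applies. -/
theorem dotConj_I_smul_im (z ζ : Cn n) : (dotConj (Complex.I • z) ζ).im = ⟪ζ, z⟫_ℝ := by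
  rw [dotConj_smul, Complex.I_mul_im, dotConj, PiLp.inner_apply, Complex.re_sum]
  refine Finset.sum_congr rfl fun j _ => ?_
  simp [Complex.inner]

theorem exists_forall_norm_le_ae_sphereMeasure {F : Type*} [NormedAddCommGroup F] (hr : 0 ≤ r)
    {u : Cn n → F} (hu : Continuous u) : ∃ B, ∀ᵐ ζ ∂(sphereMeasure n r), ‖u ζ‖ ≤ B := by
  obtain ⟨B, hB⟩ := (isCompact_sphere (0 : Cn n) r).exists_bound_of_continuousOn hu.continuousOn
  refine ⟨B, ?_⟩
  filter_upwards [ae_norm_eq_sphereMeasure n hr] with ζ hζ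
  exact hB ζ (by simpa using hζ)

theorem integrable_continuous_mul_sphereMeasure (hr : 0 ≤ r) {u g : Cn n → ℂ} (hu : Continuous u)
    (hg : Integrable g (sphereMeasure n r)) :
    Integrable (fun ζ => u ζ * g ζ) (sphereMeasure n r) := by
  obtain ⟨B, hB⟩ := exists_forall_norm_le_ae_sphereMeasure hr hu
  exact hg.bdd_mul hu.aestronglyMeasurable hB

/-- The moments `∫ Im (z · ζ̄)ᵏ g(ζ) dσ_r(ζ)` form a sequence of homogeneous polynomials in `z` that
the Laplacian lowers by two steps, so by induction all of them vanish if they vanish on a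
non-harmonic set. -/
theorem momentPoly_eq_zero_of_nonHarmonic (hr : 0 ≤ r) {C : Set (Cn n)} (hC : NonHarmonic C)
    {g : Cn n → ℂ} (hg : Integrable g (sphereMeasure n r))
    (h : ∀ z ∈ C, ∀ k : ℕ, ∫ ζ, ((dotConj z ζ).im : ℂ) ^ k * g ζ ∂(sphereMeasure n r) = 0)
    (k : ℕ) : momentPoly (sphereMeasure n r) symplecticCoeff g k = 0 := by
  have hi : ∀ k s, Integrable (fun ζ =>
      MvPolynomial.coeff s (linForm (symplecticCoeff ζ) ^ k) * g ζ) (sphereMeasure n r) :=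
    fun k s => integrable_continuous_mul_sphereMeasure hr
      (continuous_coeff_linForm_pow continuous_symplecticCoeff k s) hg
  have hR : ∀ᵐ ζ ∂(sphereMeasure n r), ∑ v, symplecticCoeff ζ v ^ 2 = ((r ^ 2 : ℝ) : ℂ) := by
    filter_upwards [ae_norm_eq_sphereMeasure n hr] with ζ hζ
    rw [sum_symplecticCoeff_sq, hζ]
  induction k using Nat.strong_induction_on with
  | _ k ih =>
    by_contra hne
    refine hC k _ (isHomogeneous_momentPoly _ _ _ k) ?_ hne fun z hz => ?_
    · rcases lt_or_ge k 2 with hk | hk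
      · exact laplacian_momentPoly_of_lt_two hk
      · obtain ⟨m, rfl⟩ := Nat.exists_eq_add_of_le' hk
        rw [RealPoly.laplacian, laplacian_momentPoly_add_two (hi _) hR, ih m (by omega), mul_zero]
    · simp only [Set.mem_ofPred_eq, RealPoly.evalAt]
      rw [eval_momentPoly (hi k)]
      simpa only [sum_symplecticCoeff_mul] using h z hz k

theorem ae_eq_zero_of_symplecticFourier_eq_zero (hr : 0 ≤ r) {C : Set (Cn n)} (hC : IsRealCone C)
    (hnh : NonHarmonic C) {lam : ℝ} (hlam : lam ≠ 0) {g : Cn n → ℂ}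
    (hg : Integrable g (sphereMeasure n r))
    (h : ∀ z ∈ C, ∫ ζ, Complex.exp (-(Complex.I * (lam * (dotConj z ζ).im : ℝ))) * g ζ
      ∂(sphereMeasure n r) = 0) :
    g =ᵐ[sphereMeasure n r] 0 := by
  have hB : ∀ z : Cn n, ∃ B, ∀ᵐ ζ ∂(sphereMeasure n r), |(dotConj z ζ).im| ≤ B :=
    fun z => exists_forall_norm_le_ae_sphereMeasure hr (continuous_dotConj_im z)
  have hm : ∀ z : Cn n, AEStronglyMeasurable (fun ζ => (dotConj z ζ).im) (sphereMeasure n r) :=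
    fun z => (continuous_dotConj_im z).aestronglyMeasurable
  have hmom : ∀ z ∈ C, ∀ k : ℕ,
      ∫ ζ, ((dotConj z ζ).im : ℂ) ^ k * g ζ ∂(sphereMeasure n r) = 0 := by
    intro z hz k
    obtain ⟨B, hB⟩ := hB z
    refine moments_eq_zero_of_fourier_eq_zero (hm z) hB hg (fun s => ?_) k
    -- The cone contains -(s/λ)z, at which the phase becomes s Im(z·ζ̄); all s are thus available.
    rw [← h _ (hC (-(s / lam)) z hz)]
    refine integral_congr_ae (Filter.Eventually.of_forall fun ζ => ?_)
    simp only [dotConj_smul, Complex.im_ofReal_mul]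
    congr 2
    rw [← mul_neg, ← Complex.ofReal_neg]
    congr 2
    field_simp
  have hP := momentPoly_eq_zero_of_nonHarmonic hr hnh hg hmom
  refine ae_eq_zero_of_fourier_eq_zero hg fun w => ?_
  obtain ⟨B, hB⟩ := hB (Complex.I • w)
  have h1 := fourier_eq_zero_of_moments_eq_zero (hm (Complex.I • w)) hB hg fun k => by
    simp only [← sum_symplecticCoeff_mul]
    rw [← eval_momentPoly fun s => integrable_continuous_mul_sphereMeasure hr
      (continuous_coeff_linForm_pow continuous_symplecticCoeff k s) hg, hP k, map_zero]
  simpa only [dotConj_I_smul_im] using h1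

end Sphere

/-! ### From the range condition to the vanishing of μ -/

section Uniqueness

variable {n : ℕ} {r : ℝ}

theorem integrable_partialFourier {f : Cn n × ℝ → ℂ} (hf : Integrable f (cylinderMeasure n r))
    (lam : ℝ) : Integrable (partialFourier f lam) (sphereMeasure n r) := by
  have h1 : Integrable (fun p : Cn n × ℝ => Complex.exp (Complex.I * (lam * p.2 : ℝ)) * f p)
      ((sphereMeasure n r).prod volume) :=
    integrable_exp_mul hf
      (by fun_prop : Continuous fun p : Cn n × ℝ => lam * p.2).aestronglyMeasurable
  refine h1.integral_prod_left.congr (Filter.Eventually.of_forall fun ζ => ?_)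
  simp only [partialFourier, mul_comm (f _)]

/-- If the range of the modified Fourier transform is orthogonal to a scaled Hermite function for
all `ξ` in a non-harmonic cone, then the partial Fourier transform of the density vanishes. -/
theorem partialFourier_ae_eq_zero (hr : 0 ≤ r) {C : Set (Cn n)} (hC : IsRealCone C)
    (hnh : NonHarmonic C) {lam : ℝ} (hlam : lam ≠ 0) (α : Fin n → ℕ)
    {μ : ComplexMeasure (Cn n × ℝ)}
    (h : ∀ ξ ∈ C, Set.range (modifiedFourier n r μ ξ lam) ⊆ ((hermiteLine α lam)ᗮ : Set (L2 n))) :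
    partialFourier (density n r μ) lam =ᵐ[sphereMeasure n r] 0 := by
  have : Fact ((2 : ℝ≥0∞) ≠ ∞) := ⟨by simp⟩
  set F := partialFourier (density n r μ) lam
  have hFi : Integrable F (sphereMeasure n r) :=
    integrable_partialFourier (ComplexMeasure.integrable_rnDeriv _ _) lam
  have hFπ : ∀ φ : L2 n, Integrable (fun ζ => F ζ • schrodinger lam ζ 0 φ) (sphereMeasure n r) :=
    fun φ => hFi.smul_bdd ‖φ‖ (stronglyMeasurable_schrodinger lam φ).aestronglyMeasurable
      (Filter.Eventually.of_forall fun ζ => (norm_schrodinger lam ζ 0 φ).le)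
  have key : ∀ φ : L2 n, ∀ᵐ ζ ∂(sphereMeasure n r),
      ⟪scaledHermite α lam, F ζ • schrodinger lam ζ 0 φ⟫_ℂ = 0 := by
    intro φ
    refine ae_eq_zero_of_symplecticFourier_eq_zero hr hC hnh hlam ((hFπ φ).const_inner _)
      fun z hz => ?_
    have h1 : ⟪scaledHermite α lam, modifiedFourier n r μ z lam φ⟫_ℂ = 0 :=
      (Submodule.mem_orthogonal _ _).1 (h z hz ⟨φ, rfl⟩) _ (Submodule.mem_span_singleton_self _)
    have h2 : Integrable (fun ζ => (Complex.exp (-(Complex.I * (lam * (dotConj z ζ).im : ℝ))) * F ζ) •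
        schrodinger lam ζ 0 φ) (sphereMeasure n r) := by
      simp only [mul_smul]
      refine (hFπ φ).bdd_smul (φ := fun ζ : Cn n =>
        Complex.exp (-(Complex.I * (lam * (dotConj z ζ).im : ℝ)))) 1 ?_ (Filter.Eventually.of_forall fun ζ => ?_)
      · have := continuous_dotConj_im z
        exact Continuous.aestronglyMeasurable (by fun_prop)
      · rw [← mul_neg, ← Complex.ofReal_neg]
        exact norm_exp_I_mul_ofReal_le _
    rw [modifiedFourier, ← integral_inner h2] at h1
    rw [← h1]
    refine integral_congr_ae (Filter.Eventually.of_forall fun ζ => ?_)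
    simp only [inner_smul_right, mul_assoc]
  -- The exceptional null set in `key` depends on φ; a countable dense sequence gives a common one,
  -- and continuity in φ recovers all of L².
  have hall : ∀ᵐ ζ ∂(sphereMeasure n r), ∀ k : ℕ,
      ⟪scaledHermite α lam,
        F ζ • schrodinger lam ζ 0 (TopologicalSpace.denseSeq (L2 n) k)⟫_ℂ = 0 :=
    ae_all_iff.2 fun k => key _
  filter_upwards [hall] with ζ hζ
  by_contra hne
  have h0 : ∀ φ : L2 n, ⟪scaledHermite α lam, schrodinger lam ζ 0 φ⟫_ℂ = 0 := by
    have hc : Continuous fun φ : L2 n => ⟪scaledHermite α lam, schrodinger lam ζ 0 φ⟫_ℂ :=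
      continuous_const.inner (continuous_schrodinger lam ζ 0)
    have := (TopologicalSpace.denseRange_denseSeq (L2 n)).equalizer hc
      (continuous_const (y := (0 : ℂ))) (funext fun k => by
        have := hζ k
        rw [inner_smul_right] at this
        exact (mul_eq_zero.1 this).resolve_left hne)
    exact congrFun this
  -- This φ is the preimage of the Hermite function under π_λ(ζ), so the pairing becomes its squared
  -- norm.
  have h3 := h0 (schrodinger lam (-ζ) 0 (scaledHermite α lam))
  rw [schrodinger_neg_right_inverse] at h3
  exact scaledHermite_ne_zero α hlam (inner_self_eq_zero.1 h3)

/-- Nonzero rational λ share one null set of ζ. For almost every other ζ, continuity in λ extends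
the vanishing to all real λ, including 0, and Fourier uniqueness in t applies on the fibre. -/
theorem ae_eq_zero_of_partialFourier_eq_zero {f : Cn n × ℝ → ℂ}
    (hf : Integrable f (cylinderMeasure n r))
    (h : ∀ lam : ℝ, lam ≠ 0 → partialFourier f lam =ᵐ[sphereMeasure n r] 0) :
    f =ᵐ[cylinderMeasure n r] 0 := by
  have hq : ∀ᵐ ζ ∂(sphereMeasure n r), ∀ q : ℚ, (q : ℝ) ≠ 0 → partialFourier f q ζ = 0 :=
    ae_all_iff.2 fun q => by
      by_cases hq : (q : ℝ) = 0
      · exact Filter.Eventually.of_forall fun ζ hne => absurd hq hne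
      · filter_upwards [h q hq] with ζ hζ _
        exact hζ
  have hfib : ∀ᵐ ζ ∂(sphereMeasure n r), ∀ᵐ t : ℝ, f (ζ, t) = 0 := by
    filter_upwards [hq, hf.prod_right_ae] with ζ h0 hi
    have hc : Continuous fun lam : ℝ => partialFourier f lam ζ := by
      unfold partialFourier
      refine continuous_of_dominated (bound := fun t => ‖f (ζ, t)‖) (fun lam => ?_) (fun lam => ?_)
        hi.norm ?_
      · exact hi.1.mul (by fun_prop : Continuous fun t : ℝ =>
          Complex.exp (Complex.I * (lam * t : ℝ))).aestronglyMeasurable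
      · refine Filter.Eventually.of_forall fun t => ?_
        rw [norm_mul]
        exact mul_le_of_le_one_right (norm_nonneg _) (norm_exp_I_mul_ofReal_le _)
      · exact Filter.Eventually.of_forall fun t => by fun_prop
    have hd : Dense {x : ℝ | ∃ q : ℚ, (q : ℝ) = x ∧ (q : ℝ) ≠ 0} := by
      have hq : Dense (Set.range ((↑) : ℚ → ℝ)) := Rat.denseRange_cast
      refine (hq.sdiff_singleton 0).mono ?_
      rintro _ ⟨⟨q, rfl⟩, hq0⟩
      exact ⟨q, rfl, hq0⟩
    have hz : ∀ lam : ℝ, partialFourier f lam ζ = 0 := by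
      have := hc.ext_on hd (continuous_const (y := (0 : ℂ))) (by
        rintro _ ⟨q, rfl, hq⟩
        exact h0 q hq)
      exact congrFun this
    refine ae_eq_zero_of_fourier_eq_zero hi fun w => ?_
    rw [← hz w]
    unfold partialFourier
    refine integral_congr_ae (Filter.Eventually.of_forall fun t => ?_)
    simp only [mul_comm (f _)]
    rfl
  have hlint : ∫⁻ p, ‖f p‖ₑ ∂(cylinderMeasure n r) = 0 := by
    rw [cylinderMeasure, lintegral_prod _ hf.1.enorm]
    refine lintegral_eq_zero_of_ae_eq_zero ?_
    filter_upwards [hfib] with ζ hζ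
    refine lintegral_eq_zero_of_ae_eq_zero ?_
    filter_upwards [hζ] with t ht
    simp [ht]
  filter_upwards [(lintegral_eq_zero_iff' hf.1.enorm).1 hlint] with p hp
  simpa using hp

theorem eq_zero_of_density_ae_eq_zero {μ : ComplexMeasure (Cn n × ℝ)}
    (hμ : μ ∈ cylinderMeasures n r) (h : density n r μ =ᵐ[cylinderMeasure n r] 0) : μ = 0 := by
  have : SigmaFinite (cylinderMeasure n r) := by unfold cylinderMeasure; infer_instance
  obtain ⟨hre, him⟩ := (ComplexMeasure.absolutelyContinuous_ennreal_iff _ _).1 hμ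
  have h1 := SignedMeasure.withDensityᵥ_rnDeriv_eq _ _ hre
  have h2 := SignedMeasure.withDensityᵥ_rnDeriv_eq _ _ him
  have h1' : (ComplexMeasure.re μ).rnDeriv (cylinderMeasure n r) =ᵐ[cylinderMeasure n r] 0 := by
    filter_upwards [h] with p hp
    exact congrArg Complex.re hp
  have h2' : (ComplexMeasure.im μ).rnDeriv (cylinderMeasure n r) =ᵐ[cylinderMeasure n r] 0 := by
    filter_upwards [h] with p hp
    exact congrArg Complex.im hp
  rw [WithDensityᵥEq.congr_ae h1', withDensityᵥ_zero] at h1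
  rw [WithDensityᵥEq.congr_ae h2', withDensityᵥ_zero] at h2
  rw [← ComplexMeasure.toComplexMeasure_to_signedMeasure μ, ← h1, ← h2]
  ext i hi
  rw [SignedMeasure.toComplexMeasure_apply]
  rfl

end Uniqueness

end HeisenbergUniqueness

open HeisenbergUniqueness
theorem mainTheorem2 (n : ℕ) (hn : 1 ≤ n) (r : ℝ) (hr : 0 < r)
    (C : Set (Cn n)) (hC : IsRealCone C ∨ IsComplexCone C) (hnh : NonHarmonic C)
    (α : ℝ → Fin n → ℕ) (μ : MeasureTheory.ComplexMeasure (Cn n × ℝ)) (hμ : μ ∈ cylinderMeasures n r)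
    (hrange : ∀ ξ ∈ C, ∀ lam : ℝ, lam ≠ 0 →
      Set.range (modifiedFourier n r μ ξ lam) ⊆ ((hermiteLine (α lam) lam)ᗮ : Set (L2 n))) :
    μ = 0 := by
  -- A complex cone is in particular a real cone.
  have hC' : IsRealCone C := hC.elim id fun h c z hz => h c z hz
  exact eq_zero_of_density_ae_eq_zero hμ <|
    ae_eq_zero_of_partialFourier_eq_zero (ComplexMeasure.integrable_rnDeriv _ _) fun lam hlam =>
      partialFourier_ae_eq_zero hr.le hC' hnh hlam (α lam) fun ξ hξ => hrange ξ hξ lam hlam
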